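/- **Theorem.** Let $P$ be a finite ground normal logic program, that is, a finite set of rules $r$ of the form $$p \leftarrow p_1 \wedge \dots \wedge p_m \wedge {\sim} p_{m+1} \wedge \dots \wedge {\sim} p_k \qquad (k \ge m \ge 0),$$ where $p, p_1, \dots, p_k$ are ground atoms; write $\mathrm{h}(r) = p$, $\mathrm{b}^+(r) = \{p_1,\dots,p_m\}$, $\mathrm{b}^-(r) = \{p_{m+1},\dots,p_k\}$, and let $\mathrm{atom}(P)$ be the set of all atoms occurring in $P$. The dependence graph $\mathrm{DG}(P)$ is the signed directed graph with vertex set $\mathrm{atom}(P)$ which has a positive (resp. negative) arc from $u$ to $v$ if and only if there is a rule $r \in P$ with $\mathrm{h}(r) = v$ and $u \in \mathrm{b}^+(r)$ (resp. $u \in \mathrm{b}^-(r)$). A cycle (without repeated vertices; loops are cycles of length one) is *negative* if it contains an odd number of negative arcs. If $\mathrm{DG}(P)$ has no negative cycle, then $P$ has at least one stable model. That is, there is a set $I \subseteq \mathrm{atom}(P)$ that is the least Herbrand model of the reduct $$P^I = \{\, \mathrm{h}(r) \leftarrow \textstyle\bigwedge_{q \in \mathrm{b}^+(r)} q \;:\;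 r \in P,\ \mathrm{b}^-(r) \cap I = \emptyset \,\},$$ where a Herbrand model of a program $Q$ is a set $J \subseteq \mathrm{atom}(Q)$ such that, for every $r \in Q$, $\mathrm{b}^+(r) \subseteq J$ and $\mathrm{b}^-(r) \cap J = \emptyset$ imply $\mathrm{h}(r) \in J$. -/

import Mathlib

namespace NormalLP

/-- A ground normal rule `head ← p₁ ∧ … ∧ pₘ ∧ ∼pₘ₊₁ ∧ … ∧ ∼pₖ` over a type `α` of ground
(variable-free) atoms, where `posBody = {p₁, …, pₘ}` and `negBody = {pₘ₊₁, …, pₖ}`. -/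
structure Rule (α : Type*) where
  head : α
  posBody : Finset α
  negBody : Finset α

/-- The atoms occurring in a rule. -/
def Rule.atoms {α : Type*} (r : Rule α) : Set α :=
  {r.head} ∪ (r.posBody : Set α) ∪ (r.negBody : Set α)

/-- A set of ground normal rules. A logic program is such a set that is finite; finiteness is
stated separately, since none of the definitions below depends on it. -/
abbrev Program (α : Type*) := Set (Rule α)

/-- The set of all atoms occurring in a program. -/
def atoms {α : Type*} (P : Program α) : Set α := {a | ∃ r ∈ P, a ∈ r.atoms}

/-- `I` is a Herbrand model of `P`: a set of atoms of `P` that is closed under the rules of `P`. -/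
def IsHerbrandModel {α : Type*} (P : Program α) (I : Set α) : Prop :=
  I ⊆ atoms P ∧
    ∀ r ∈ P, (r.posBody : Set α) ⊆ I → (r.negBody : Set α) ∩ I = ∅ → r.head ∈ I

/-- `I` is the least Herbrand model of `P` with respect to inclusion. -/
def IsLeastHerbrandModel {α : Type*} (P : Program α) (I : Set α) : Prop :=
  IsLeast {J : Set α | IsHerbrandModel P J} I

/-- The reduct of `P` with respect to `I`: rules whose negative body meets `I` are deleted, and
the negative body of every remaining rule is erased. -/
def reduct {α : Type*} (P : Program α) (I : Set α) : Program α :=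
  {r' | ∃ r ∈ P, (r.negBody : Set α) ∩ I = ∅ ∧ r' = ⟨r.head, r.posBody, ∅⟩}

/-- `I` is a stable model of `P`: a set of atoms of `P` that is the least Herbrand model of the
reduct of `P` with respect to `I`. -/
def IsStableModel {α : Type*} (P : Program α) (I : Set α) : Prop :=
  I ⊆ atoms P ∧ IsLeastHerbrandModel (reduct P I) I

/-- The two arc signs, `⊕` and `⊖`. -/
inductive ArcSign where
  | pos
  | neg
  deriving DecidableEq

/-- A signed directed graph with vertices in `α`. For every ordered pair of vertices there may be
a positive arc, a negative arc, both, or none; loops are allowed. -/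
structure SignedDigraph (α : Type*) where
  verts : Set α
  arc : α → α → ArcSign → Prop
  left_mem : ∀ {u v : α} {e : ArcSign}, arc u v e → u ∈ verts
  right_mem : ∀ {u v : α} {e : ArcSign}, arc u v e → v ∈ verts

/-- A (simple) cycle of length `n ≥ 1`: it visits the pairwise distinct vertices
`v 0, …, v (n - 1)` and returns to `v n = v 0`, where the `i`-th arc goes from `v i` to `v (i + 1)`
and has sign `s i`. Only the values `v 0, …, v n` and `s 0, …, s (n - 1)` matter.
A cycle of length `1` is a loop. -/
def SignedDigraph.IsCycle {α : Type*} (G : SignedDigraph α)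
    (n : ℕ) (v : ℕ → α) (s : ℕ → ArcSign) : Prop :=
  1 ≤ n ∧ v n = v 0 ∧ Set.InjOn v (Set.Iio n) ∧ ∀ i < n, G.arc (v i) (v (i + 1)) (s i)

/-- A negative cycle: a cycle with an odd number of negative arcs. -/
def SignedDigraph.IsNegativeCycle {α : Type*} (G : SignedDigraph α)
    (n : ℕ) (v : ℕ → α) (s : ℕ → ArcSign) : Prop :=
  G.IsCycle n v s ∧ Odd ((Finset.range n).filter (fun i => s i = ArcSign.neg)).card

/-- The arcs of the dependence graph: an arc `u → v` of sign `⊕` (resp. `⊖`) whenever `u` is in the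
positive (resp. negative) body of a rule with head `v`. -/
def depArc {α : Type*} (P : Program α) (u v : α) : ArcSign → Prop
  | ArcSign.pos => ∃ r ∈ P, v = r.head ∧ u ∈ r.posBody
  | ArcSign.neg => ∃ r ∈ P, v = r.head ∧ u ∈ r.negBody

/-- The dependence graph of a program, with the atoms of the program as its vertices. -/
def dependenceGraph {α : Type*} (P : Program α) : SignedDigraph α where
  verts := atoms P
  arc := depArc P
  left_mem := by
    intro u v e h
    cases e <;> obtain ⟨r, hr, -, hu⟩ := h <;> exact ⟨r, hr, by simp [Rule.atoms, hu]⟩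
  right_mem := by
    intro u v e h
    cases e <;> obtain ⟨r, hr, hv, -⟩ := h <;> exact ⟨r, hr, by simp [Rule.atoms, hv]⟩

end NormalLP

/-!
For a set `I` of atoms let `Γ(I)` be the set of atoms derivable from the rules of the reduct `P^I`.
A stable model is a fixed point of `Γ`, which is antitone, so that a fixed point need not exist in
general. Call a set `S` of atoms *lower* if every dependence arc ending in `S` starts in `S`. Since
membership in `Γ(I)` of an atom of `S` depends only on `I ∩ S`, it makes sense to say that `I ⊆ S`
is stable on `S`.

Take a maximal lower `S ⊆ atom(P)` carrying such an `I`, and suppose that `S ≠ atom(P)`. Among the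
strongly connected components outside `S` there is one, `C`, all of whose outside predecessors lie
in `S`. An odd closed walk contains an odd simple cycle
(`SignedDigraph.exists_isNegativeCycle_of_closed`), so there are no odd closed walks, and `C` splits
into two sides `A` and `B` such that positive arcs inside `C` stay on one side and negative arcs
change sides. Hence, given `I`, derivability on `A` depends only on the choice made on `B`, through
an antitone map `F`, and derivability on `B` depends only on the choice made on `A`, through an
antitone map `G`. The map `F ∘ G` is monotone and has a fixed point `Y` by Knaster–Tarski; then
`I ∪ Y ∪ G Y` is stable on `S ∪ C` (`IsStableOn.exists_extend`), contradicting the maximality of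
`S`.
-/

namespace NormalLP

/-! ### Closed walks with an odd number of negative arcs -/

/-- The contribution of an arc to the number of negative arcs of a walk. -/
def ArcSign.weight (e : ArcSign) : ℕ := if e = ArcSign.neg then 1 else 0

theorem ArcSign.weight_neg : ArcSign.neg.weight = 1 := rfl

/-- A closed walk with an odd number of negative arcs contains a negative cycle: cut the walk at a
repeated vertex; one of the two shorter closed walks is again odd. -/
theorem SignedDigraph.exists_isNegativeCycle_of_closed {α : Type*} (G : SignedDigraph α) (n : ℕ) :
    ∀ (v : ℕ → α) (s : ℕ → ArcSign), v n = v 0 →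
      (∀ i < n, G.arc (v i) (v (i + 1)) (s i)) →
      Odd (∑ i ∈ Finset.range n, (s i).weight) →
      ∃ (n : ℕ) (v : ℕ → α) (s : ℕ → ArcSign), G.IsNegativeCycle n v s := by
  induction n using Nat.strong_induction_on with
  | _ n ih =>
  intro v s hclosed harc hodd
  by_cases hinj : Set.InjOn v (Set.Iio n)
  · refine ⟨n, v, s, ⟨?_, hclosed, hinj, harc⟩, ?_⟩
    · rcases Nat.eq_zero_or_pos n with rfl | h
      · simp at hodd
      · exact h
    · rw [Finset.card_filter]
      exact hodd
  · have hrep : ∃ i j, i < j ∧ j < n ∧ v i = v j := by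
      simp only [Set.InjOn, Set.mem_Iio] at hinj
      push Not at hinj
      obtain ⟨i, hi, j, hj, hij, hne⟩ := hinj
      rcases lt_or_gt_of_ne hne with h | h
      · exact ⟨i, j, h, hj, hij⟩
      · exact ⟨j, i, h, hi, hij.symm⟩
    obtain ⟨i, j, hij, hjn, hv⟩ := hrep
    obtain ⟨d, rfl⟩ := Nat.exists_eq_add_of_le hij.le
    obtain ⟨e, rfl⟩ := Nat.exists_eq_add_of_le hjn.le
    by_cases hmid : Odd (∑ k ∈ Finset.range d, (s (i + k)).weight)
    · exact ih d (by omega) (fun k => v (i + k)) (fun k => s (i + k)) hv.symm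
        (fun k hk => harc (i + k) (by omega)) hmid
    · refine ih (i + e) (by omega) (fun k => if k ≤ i then v k else v (k + d))
        (fun k => if k < i then s k else s (k + d)) ?_ ?_ ?_
      · simp only [Nat.zero_le, if_true]
        rw [if_neg (by omega), ← hclosed]
        congr 1
        omega
      · intro k hk
        rcases lt_trichotomy k i with h | rfl | h
        · rw [if_pos h.le, if_pos (by omega), if_pos h]
          exact harc k (by omega)
        · rw [if_pos le_rfl, if_neg (by omega), if_neg (by omega), hv,
            show k + 1 + d = k + d + 1 by omega]
          exact harc (k + d) (by omega)
        · rw [if_neg (by omega), if_neg (by omega), if_neg (by omega),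
            show k + 1 + d = k + d + 1 by omega]
          exact harc (k + d) (by omega)
      · rw [Finset.sum_range_add, Finset.sum_range_add] at hodd
        rw [Finset.sum_range_add]
        have h1 : ∑ k ∈ Finset.range i, (if k < i then s k else s (k + d)).weight
            = ∑ k ∈ Finset.range i, (s k).weight :=
          Finset.sum_congr rfl fun k hk => by rw [if_pos (Finset.mem_range.mp hk)]
        have h2 : ∑ k ∈ Finset.range e, (if i + k < i then s (i + k) else s (i + k + d)).weight
            = ∑ k ∈ Finset.range e, (s (i + d + k)).weight :=
          Finset.sum_congr rfl fun k _ => by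
            rw [if_neg (by omega), show i + k + d = i + d + k by omega]
        rw [h1, h2]
        rw [Nat.not_odd_iff_even] at hmid
        rw [Nat.odd_iff] at hodd ⊢
        rw [Nat.even_iff] at hmid
        omega

/-- `G.Walk u v k`: there is a walk from `u` to `v` with exactly `k` negative arcs, counted with
multiplicity. -/
inductive SignedDigraph.Walk {α : Type*} (G : SignedDigraph α) (u : α) : α → ℕ → Prop
  | nil : Walk G u u 0
  | snoc {v w : α} {k : ℕ} {e : ArcSign} (h : Walk G u v k) (harc : G.arc v w e) :
      Walk G u w (k + e.weight)

namespace SignedDigraph.Walk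

variable {α : Type*} {G : SignedDigraph α} {u v w : α} {k l : ℕ}

theorem trans (h : G.Walk u v k) (h' : G.Walk v w l) : G.Walk u w (k + l) := by
  induction h' with
  | nil => exact h
  | snoc _ harc ih => rw [← Nat.add_assoc]; exact ih.snoc harc

theorem of_arc {e : ArcSign} (h : G.arc u v e) : G.Walk u v e.weight := by
  simpa using Walk.nil.snoc h

theorem exists_seq (h : G.Walk u v k) :
    ∃ (n : ℕ) (f : ℕ → α) (s : ℕ → ArcSign), f 0 = u ∧ f n = v ∧
      (∀ i < n, G.arc (f i) (f (i + 1)) (s i)) ∧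
      ∑ i ∈ Finset.range n, (s i).weight = k := by
  induction h with
  | nil => exact ⟨0, fun _ => u, fun _ => ArcSign.pos, rfl, rfl, by simp, by simp⟩
  | @snoc v w k e _ harc ih =>
    obtain ⟨n, f, s, h0, hn, ha, hs⟩ := ih
    refine ⟨n + 1, fun i => if i ≤ n then f i else w, fun i => if i < n then s i else e,
      by simpa using h0, by simp, ?_, ?_⟩
    · intro i hi
      dsimp only
      rcases (Nat.lt_succ_iff.mp hi).lt_or_eq with h | rfl
      · rw [if_pos h.le, if_pos (by omega), if_pos h]
        exact ha i h
      · rw [if_pos le_rfl, if_neg (by omega), if_neg (by omega), hn]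
        exact harc
    · dsimp only
      rw [Finset.sum_range_succ, if_neg (lt_irrefl n), ← hs]
      congr 1
      exact Finset.sum_congr rfl fun i hi => by rw [if_pos (Finset.mem_range.mp hi)]

theorem even_of_closed (hneg : ¬ ∃ (n : ℕ) (v : ℕ → α) (s : ℕ → ArcSign), G.IsNegativeCycle n v s)
    (h : G.Walk u u k) : Even k := by
  by_contra hk
  obtain ⟨n, f, s, h0, hn, ha, hs⟩ := h.exists_seq
  exact hneg (G.exists_isNegativeCycle_of_closed n f s (hn.trans h0.symm) ha
    (by rw [hs]; exact Nat.not_even_iff_odd.mp hk))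

end SignedDigraph.Walk

/-! ### Derivability in the reduct -/

/-- `Derives P I a`: the atom `a` is derivable by the rules of the reduct of `P` with respect
to `I`. -/
inductive Derives {α : Type*} (P : Program α) (I : Set α) : α → Prop
  | rule (r : Rule α) (hr : r ∈ P) (hpos : ∀ q ∈ r.posBody, Derives P I q)
      (hneg : ∀ q ∈ r.negBody, q ∉ I) : Derives P I r.head

variable {α : Type*} {P : Program α} {I J S : Set α}

/-- Derivability is antitone in the assumed set, and on a set `T` that contains the positive
bodies of the rules for its members, only assumptions about the negative bodies of these rules
matter. -/
theorem Derives.anti_on {T : Set α} (hpos : ∀ u, ∀ v ∈ T, depArc P u v ArcSign.pos → u ∈ T)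
    (hneg : ∀ u, ∀ v ∈ T, depArc P u v ArcSign.neg → u ∈ I → u ∈ J) {a : α} (haT : a ∈ T)
    (ha : Derives P J a) : Derives P I a := by
  induction ha with
  | rule r hr _ hn ih =>
    exact .rule r hr (fun q hq => ih q hq (hpos q _ haT ⟨r, hr, rfl, hq⟩))
      (fun q hq hqI => hn q hq (hneg q _ haT ⟨r, hr, rfl, hq⟩ hqI))

theorem Derives.anti (hIJ : I ⊆ J) {a : α} (ha : Derives P J a) : Derives P I a :=
  ha.anti_on (T := Set.univ) (fun _ _ _ _ => trivial) (fun _ _ _ _ h => hIJ h) trivial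

theorem derives_congr_on {T : Set α} (hpos : ∀ u, ∀ v ∈ T, depArc P u v ArcSign.pos → u ∈ T)
    (hneg : ∀ u, ∀ v ∈ T, depArc P u v ArcSign.neg → (u ∈ I ↔ u ∈ J)) {a : α} (haT : a ∈ T) :
    Derives P I a ↔ Derives P J a :=
  ⟨Derives.anti_on hpos (fun u v hv h => (hneg u v hv h).2) haT,
    Derives.anti_on hpos (fun u v hv h => (hneg u v hv h).1) haT⟩

theorem Derives.mem_atoms {a : α} (h : Derives P I a) : a ∈ atoms P := by
  cases h with
  | rule r hr _ _ => exact ⟨r, hr, by simp [Rule.atoms]⟩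

theorem isStableModel_of_derives (h : ∀ a, a ∈ I ↔ Derives P I a) : IsStableModel P I := by
  refine ⟨fun a ha => ((h a).1 ha).mem_atoms, ⟨?_, ?_⟩, ?_⟩
  · intro a ha
    cases (h a).1 ha with
    | rule r hr _ hn =>
      refine ⟨⟨r.head, r.posBody, ∅⟩, ⟨r, hr, ?_, rfl⟩, by simp [Rule.atoms]⟩
      exact Set.disjoint_iff_inter_eq_empty.mp (Set.disjoint_left.mpr fun q hq => hn q hq)
  · rintro _ ⟨r, hr, hn, rfl⟩ hp -
    refine (h _).2 (.rule r hr (fun q hq => (h q).1 (hp hq)) fun q hq hqI => ?_)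
    exact Set.notMem_empty q (hn ▸ ⟨hq, hqI⟩)
  · intro J hJ a ha
    have hd := (h a).1 ha
    clear ha
    induction hd with
    | rule r hr _ hn ih =>
      refine hJ.2 ⟨r.head, r.posBody, ∅⟩ ⟨r, hr, ?_, rfl⟩ (fun q hq => ih q hq) (by simp)
      exact Set.disjoint_iff_inter_eq_empty.mp (Set.disjoint_left.mpr fun q hq => hn q hq)

theorem finite_atoms (hfin : P.Finite) : (atoms P).Finite := by
  have : atoms P = ⋃ r ∈ P, r.atoms := by
    ext a
    simp [atoms]
  rw [this]
  refine hfin.biUnion fun r _ => ?_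
  exact ((Set.finite_singleton _).union r.posBody.finite_toSet).union r.negBody.finite_toSet

/-! ### Extending a partial stable model -/

/-- A set of atoms is lower if it contains the body atoms of every rule whose head it contains. -/
def IsLower (P : Program α) (S : Set α) : Prop :=
  ∀ u, ∀ v ∈ S, ∀ e, depArc P u v e → u ∈ S

/-- `I ⊆ S` satisfies the fixed-point equation of stable models at the atoms of `S`. -/
def IsStableOn (P : Program α) (S I : Set α) : Prop :=
  I ⊆ S ∧ ∀ a ∈ S, a ∈ I ↔ Derives P I a

/-- A set stable on a lower set `S` extends over two further sides `A` and `B`, provided that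
positive arcs into a side come from `S` or the same side, and negative arcs from `S` or the
opposite side. -/
theorem IsStableOn.exists_extend (hS : IsLower P S) (hI : IsStableOn P S I) {A B : Set α}
    (hAS : Disjoint A S) (hBS : Disjoint B S) (hAB : Disjoint A B)
    (hAp : ∀ u, ∀ v ∈ A, depArc P u v ArcSign.pos → u ∈ S ∪ A)
    (hAn : ∀ u, ∀ v ∈ A, depArc P u v ArcSign.neg → u ∈ S ∪ B)
    (hBp : ∀ u, ∀ v ∈ B, depArc P u v ArcSign.pos → u ∈ S ∪ B)
    (hBn : ∀ u, ∀ v ∈ B, depArc P u v ArcSign.neg → u ∈ S ∪ A) :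
    ∃ K, IsStableOn P (S ∪ A ∪ B) K := by
  let F : Set α → Set α := fun X => {a | a ∈ A ∧ Derives P (I ∪ X) a}
  let G : Set α → Set α := fun Y => {b | b ∈ B ∧ Derives P (I ∪ Y) b}
  have hF : Antitone F := fun X X' h a ha => ⟨ha.1, ha.2.anti (Set.union_subset_union_right I h)⟩
  have hG : Antitone G := fun X X' h a ha => ⟨ha.1, ha.2.anti (Set.union_subset_union_right I h)⟩
  obtain ⟨Y, hY⟩ : ∃ Y, F (G Y) = Y := ⟨_, OrderHom.map_lfp ⟨F ∘ G, hF.comp hG⟩⟩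
  obtain ⟨X, hX⟩ : ∃ X, G Y = X := ⟨_, rfl⟩
  rw [hX] at hY
  have hYA : Y ⊆ A := fun a ha => by rw [← hY] at ha; exact ha.1
  have hXB : X ⊆ B := fun a ha => by rw [← hX] at ha; exact ha.1
  rw [Set.disjoint_left] at hAS hBS hAB
  have memS : ∀ a ∈ S, a ∈ I ∪ Y ∪ X ↔ a ∈ I := fun a ha =>
    ⟨by rintro ((h | h) | h)
        exacts [h, (hAS (hYA h) ha).elim, (hBS (hXB h) ha).elim], fun h => .inl (.inl h)⟩
  have memA : ∀ a ∈ A, a ∈ I ∪ Y ∪ X ↔ a ∈ Y := fun a ha =>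
    ⟨by rintro ((h | h) | h)
        exacts [(hAS ha (hI.1 h)).elim, h, (hAB ha (hXB h)).elim], fun h => .inl (.inr h)⟩
  have memB : ∀ a ∈ B, a ∈ I ∪ Y ∪ X ↔ a ∈ X := fun a ha =>
    ⟨by rintro ((h | h) | h)
        exacts [(hBS ha (hI.1 h)).elim, (hAB (hYA h) ha).elim, h], fun h => .inr h⟩
  refine ⟨I ∪ Y ∪ X, Set.union_subset_union (Set.union_subset_union hI.1 hYA) hXB, ?_⟩
  rintro a ((ha | ha) | ha)
  · rw [memS a ha, hI.2 a ha]
    exact derives_congr_on (fun u v hv h => hS u v hv _ h)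
      (fun u v hv h => (memS u (hS u v hv _ h)).symm) ha
  · rw [memA a ha, show a ∈ Y ↔ Derives P (I ∪ X) a by
      conv_lhs => rw [← hY]
      exact and_iff_right ha]
    refine derives_congr_on (T := S ∪ A) ?_ ?_ (.inr ha)
    · rintro u v (hv | hv) h
      exacts [.inl (hS u v hv _ h), hAp u v hv h]
    · have key : ∀ u ∈ S ∪ B, u ∈ I ∪ X ↔ u ∈ I ∪ Y ∪ X := by
        intro u hu
        refine ⟨fun h => h.imp_left .inl, ?_⟩
        rintro ((h | h) | h)
        exacts [.inl h, (hu.elim (hAS (hYA h)) (hAB (hYA h))).elim, .inr h]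
      rintro u v (hv | hv) h
      exacts [key u (.inl (hS u v hv _ h)), key u (hAn u v hv h)]
  · rw [memB a ha, show a ∈ X ↔ Derives P (I ∪ Y) a by
      conv_lhs => rw [← hX]
      exact and_iff_right ha]
    refine derives_congr_on (T := S ∪ B) ?_ ?_ (.inr ha)
    · rintro u v (hv | hv) h
      exacts [.inl (hS u v hv _ h), hBp u v hv h]
    · have key : ∀ u ∈ S ∪ A, u ∈ I ∪ Y ↔ u ∈ I ∪ Y ∪ X := by
        intro u hu
        refine ⟨.inl, ?_⟩
        rintro (h | h)
        exacts [h, (hu.elim (hBS (hXB h)) (fun h' => hAB h' (hXB h))).elim]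
      rintro u v (hv | hv) h
      exacts [key u (.inl (hS u v hv _ h)), key u (hBn u v hv h)]

/-- Unless a lower set `S` contains all atoms, a stable set on it extends to a strictly larger
lower set, obtained by adding a strongly connected component. -/
theorem IsStableOn.exists_ssubset (hfin : P.Finite)
    (hneg : ¬ ∃ (n : ℕ) (v : ℕ → α) (s : ℕ → ArcSign), (dependenceGraph P).IsNegativeCycle n v s)
    (hS : IsLower P S) (hSP : S ⊆ atoms P) (hne : S ≠ atoms P) (hI : IsStableOn P S I) :
    ∃ S', S ⊂ S' ∧ S' ⊆ atoms P ∧ IsLower P S' ∧ ∃ K, IsStableOn P S' K := by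
  let Γ := dependenceGraph P
  obtain ⟨x, hxP, hxS⟩ := Set.exists_of_ssubset (hSP.ssubset_of_ne hne)
  obtain ⟨a, ⟨haP, haS⟩, hmin⟩ := ((finite_atoms hfin).sdiff (t := S)).exists_minimalFor
    (fun b => {c | ∃ k, Γ.Walk c b k}) _ ⟨x, hxP, hxS⟩
  -- By minimality, the component of `a` absorbs everything outside `S` from which `a` is reachable.
  have hback : ∀ b, b ∈ atoms P → b ∉ S → (∃ k, Γ.Walk b a k) → ∃ k, Γ.Walk a b k := by
    rintro b hbP hbS ⟨k, hk⟩
    exact hmin ⟨hbP, hbS⟩ (fun c ⟨l, hl⟩ => ⟨_, hl.trans hk⟩) ⟨0, .nil⟩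
  -- The sides of the component: the parity of the number of negative arcs on walks from `a`.
  let A : Set α := {b | b ∈ atoms P ∧ b ∉ S ∧ (∃ k, Γ.Walk b a k) ∧ ∃ k, Γ.Walk a b k ∧ Even k}
  let B : Set α := {b | b ∈ atoms P ∧ b ∉ S ∧ (∃ k, Γ.Walk b a k) ∧ ∃ k, Γ.Walk a b k ∧ Odd k}
  have hpar : ∀ b k l, (∃ m, Γ.Walk b a m) → Γ.Walk a b k → Γ.Walk a b l → (Even k ↔ Even l) := by
    rintro b k l ⟨m, hm⟩ hk hl
    have h1 := (hk.trans hm).even_of_closed hneg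
    have h2 := (hl.trans hm).even_of_closed hneg
    rw [Nat.even_add] at h1 h2
    exact h1.trans h2.symm
  have hpred : ∀ u v e, v ∈ atoms P → v ∉ S → (∃ k, Γ.Walk v a k) → depArc P u v e → u ∉ S →
      u ∈ atoms P ∧ (∃ k, Γ.Walk u a k) ∧ ∃ k, Γ.Walk a u k ∧ Γ.Walk a v (k + e.weight) := by
    rintro u v e hvP hvS ⟨k, hk⟩ harc huS
    have harc' : Γ.arc u v e := harc
    have huP : u ∈ atoms P := Γ.left_mem harc'
    have hua : ∃ k, Γ.Walk u a k := ⟨_, (SignedDigraph.Walk.of_arc harc').trans hk⟩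
    obtain ⟨l, hl⟩ := hback u huP huS hua
    exact ⟨huP, hua, l, hl, hl.snoc harc'⟩
  have hAp : ∀ u, ∀ v ∈ A, depArc P u v ArcSign.pos → u ∈ S ∪ A := by
    rintro u v ⟨hvP, hvS, hva, k, hk, hev⟩ h
    by_contra hu
    rw [Set.mem_union, not_or] at hu
    obtain ⟨huP, hua, l, hl, hl'⟩ := hpred u v _ hvP hvS hva h hu.1
    exact hu.2 ⟨huP, hu.1, hua, l, hl, (hpar v _ _ hva hk hl').1 hev⟩
  have hAn : ∀ u, ∀ v ∈ A, depArc P u v ArcSign.neg → u ∈ S ∪ B := by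
    rintro u v ⟨hvP, hvS, hva, k, hk, hev⟩ h
    by_contra hu
    rw [Set.mem_union, not_or] at hu
    obtain ⟨huP, hua, l, hl, hl'⟩ := hpred u v _ hvP hvS hva h hu.1
    have := (hpar v _ _ hva hk hl').1 hev
    rw [ArcSign.weight_neg, Nat.even_add_one, Nat.not_even_iff_odd] at this
    exact hu.2 ⟨huP, hu.1, hua, l, hl, this⟩
  have hBp : ∀ u, ∀ v ∈ B, depArc P u v ArcSign.pos → u ∈ S ∪ B := by
    rintro u v ⟨hvP, hvS, hva, k, hk, hodd⟩ h
    by_contra hu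
    rw [Set.mem_union, not_or] at hu
    obtain ⟨huP, hua, l, hl, hl'⟩ := hpred u v _ hvP hvS hva h hu.1
    rw [← Nat.not_even_iff_odd, hpar v _ _ hva hk hl', Nat.not_even_iff_odd] at hodd
    exact hu.2 ⟨huP, hu.1, hua, l, hl, hodd⟩
  have hBn : ∀ u, ∀ v ∈ B, depArc P u v ArcSign.neg → u ∈ S ∪ A := by
    rintro u v ⟨hvP, hvS, hva, k, hk, hodd⟩ h
    by_contra hu
    rw [Set.mem_union, not_or] at hu
    obtain ⟨huP, hua, l, hl, hl'⟩ := hpred u v _ hvP hvS hva h hu.1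
    rw [← Nat.not_even_iff_odd, hpar v _ _ hva hk hl', ArcSign.weight_neg, Nat.even_add_one,
      not_not] at hodd
    exact hu.2 ⟨huP, hu.1, hua, l, hl, hodd⟩
  refine ⟨S ∪ A ∪ B, ?_, ?_, ?_, hI.exists_extend hS ?_ ?_ ?_ hAp hAn hBp hBn⟩
  · refine (Set.ssubset_iff_of_subset fun b hb => .inl (.inl hb)).2
      ⟨a, .inl (.inr ⟨haP, haS, ⟨0, .nil⟩, 0, .nil, Even.zero⟩), haS⟩
  · rintro b ((hb | hb) | hb)
    exacts [hSP hb, hb.1, hb.1]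
  · rintro u v ((hv | hv) | hv) (_ | _) h
    · exact .inl (.inl (hS u v hv _ h))
    · exact .inl (.inl (hS u v hv _ h))
    · exact .inl (hAp u v hv h)
    · exact (hAn u v hv h).imp_left .inl
    · exact (hBp u v hv h).imp_left .inl
    · exact .inl (hBn u v hv h)
  · exact Set.disjoint_left.mpr fun b hb => hb.2.1
  · exact Set.disjoint_left.mpr fun b hb => hb.2.1
  · rw [Set.disjoint_left]
    rintro b ⟨-, -, hba, k, hk, hev⟩ ⟨-, -, -, l, hl, hodd⟩
    exact Nat.not_even_iff_odd.mpr hodd ((hpar b k l hba hk hl).1 hev)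

end NormalLP

theorem mainTheorem1 {α : Type*} (P : NormalLP.Program α) (hfin : P.Finite)
    (hneg : ¬ ∃ (n : ℕ) (v : ℕ → α) (s : ℕ → NormalLP.ArcSign),
      (NormalLP.dependenceGraph P).IsNegativeCycle n v s) :
    ∃ I : Set α, NormalLP.IsStableModel P I := by
  have hfinite : {S | S ⊆ NormalLP.atoms P ∧ NormalLP.IsLower P S ∧
      ∃ I, NormalLP.IsStableOn P S I}.Finite :=
    (NormalLP.finite_atoms hfin).finite_subsets.subset fun S hS => hS.1
  obtain ⟨S, ⟨hSP, hS, I, hI⟩, hmax⟩ := hfinite.exists_maximal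
    ⟨∅, Set.empty_subset _, fun _ _ hv => hv.elim, ∅, subset_rfl, fun _ ha => ha.elim⟩
  by_cases hne : S = NormalLP.atoms P
  · subst hne
    exact ⟨I, NormalLP.isStableModel_of_derives fun a =>
      ⟨fun ha => (hI.2 a (hI.1 ha)).1 ha, fun ha => (hI.2 a ha.mem_atoms).2 ha⟩⟩
  · obtain ⟨S', hlt, hS'P, hS', hK⟩ := hI.exists_ssubset hfin hneg hS hSP hne
    exact (hlt.2 (hmax ⟨hS'P, hS', hK⟩ hlt.1)).elim
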